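/- Let $\tau:E\to M$ and $\tau':E'\to M'$ be smooth Lie algebroids of finite rank over finite-dimensional smooth (Hausdorff) manifolds without boundary, with anchors $\rho,\rho'$ and brackets $[\cdot,\cdot]$, $[\cdot,\cdot]'$ on smooth sections. Let $d$ denote the exterior differential of a Lie algebroid, given on a $p$-form $\theta\in\mathrm{Sec}(\wedge^pE^*)$ by $$d\theta(\sigma_0,\dots,\sigma_p)=\sum_i(-1)^i\rho(\sigma_i)\bigl(\theta(\sigma_0,\dots,\widehat{\sigma_i},\dots,\sigma_p)\bigr)+\sum_{i<j}(-1)^{i+j}\theta([\sigma_i,\sigma_j],\sigma_0,\dots,\widehat{\sigma_i},\dots,\widehat{\sigma_j},\dots,\sigma_p).$$ A smooth vector bundle map $\Phi:E\to E'$ over a smooth map $\varphi:M\to M'$ is a morphism of Lie algebroids if $\Phi^\star d\theta=d\,\Phi^\star\theta$ for every $p\ge 0$ and every $p$-form $\theta$ on $E'$. Let $t_0<t_1$. An $E$-path is a $C^1$ curve $a:[t_0,t_1]\to E$ whose base curve $\gamma=\tau\circ a$ satisfies $\dot\gamma(t)=\rho(a(t))$ for all $t\in[t_0,t_1]$. For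 a Lagrangian $L\in C^\infty(E)$, an $E$-path $a$ is a solution of Lagrange's equations for $L$ if, for every local basis $\{e_\alpha\}$ of sections of $E$, with structure functions $\rho(e_\alpha)=\rho^i_\alpha\,\partial/\partial x^i$ and $[e_\alpha,e_\beta]=C^\gamma_{\alpha\beta}e_\gamma$ and with associated fibred coordinates $(x^i,y^\alpha)$ on $E$, the function $\partial L/\partial y^\alpha$ is differentiable along $a$ and $$\frac{d}{dt}\Bigl(\frac{\partial L}{\partial y^\alpha}\Bigr)+\frac{\partial L}{\partial y^\gamma}C^\gamma_{\alpha\beta}y^\beta-\rho^i_\alpha\frac{\partial L}{\partial x^i}=0$$ holds along $a$ for every $\alpha$, at all $t\in[t_0,t_1]$ for which $\gamma(t)$ lies in the domain of the local basis (the remaining equation $\dot x^i=\rho^i_\alpha y^\alpha$ is the condition that $a$ is an $E$-path). Theorem. Let $\Phi:E\to E'$ be a morphism of Lie algebroids, and let $L\in C^\infty(E)$ and $L'\in C^\infty(E')$ be Lagrangians with $L=L'\circ\Phi$. If $a:[t_0,t_1]\to E$ is an $E$-path and $a'=\Phi\circ a$ is a solution of Lagrange's equations for $L'$, then $a$ is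 a solution of Lagrange's equations for $L$. -/

import Mathlib

open Bundle Set
open scoped Manifold ContDiff Bundle

noncomputable section

section LieAlgebroids

variable {EM : Type*} [NormedAddCommGroup EM] [NormedSpace ℝ EM]
  {H : Type*} [TopologicalSpace H] (I : ModelWithCorners ℝ EM H)
  {M : Type*} [TopologicalSpace M] [ChartedSpace H M]
  (F : Type*) [NormedAddCommGroup F] [NormedSpace ℝ F]
  (V : M → Type*) [TopologicalSpace (TotalSpace F V)]
  [∀ x, AddCommGroup (V x)] [∀ x, Module ℝ (V x)] [∀ x, TopologicalSpace (V x)]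
  [FiberBundle F V] [VectorBundle ℝ F V]

/-- A Lie algebroid structure on the vector bundle `V → M`: a smooth bundle map `V → TM` over the
identity (the anchor), and a real Lie algebra structure on the smooth sections of `V` such that
`[σ, f η] = (ρ(σ) f) η + f [σ, η]` for every smooth function `f`. -/
structure LieAlgebroid [IsManifold I ∞ M] where
  anchor : ∀ x : M, V x →ₗ[ℝ] TangentSpace I x
  contMDiff_anchor : ContMDiff (I.prod 𝓘(ℝ, F)) I.tangent ∞
    (fun v : TotalSpace F V => (⟨v.proj, anchor v.proj v.2⟩ : TangentBundle I M))
  bracket : Cₛ^∞⟮I; F, V⟯ →ₗ[ℝ] Cₛ^∞⟮I; F, V⟯ →ₗ[ℝ] Cₛ^∞⟮I; F, V⟯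
  bracket_self : ∀ σ, bracket σ σ = 0
  jacobi : ∀ σ η ζ,
    bracket σ (bracket η ζ) + bracket η (bracket ζ σ) + bracket ζ (bracket σ η) = 0
  leibniz : ∀ (σ η : Cₛ^∞⟮I; F, V⟯) (f : M → ℝ) (hf : ContMDiff I 𝓘(ℝ, ℝ) ∞ f) (x : M),
    bracket σ ⟨f • ⇑η, hf.smul_section η.contMDiff⟩ x =
      mvfderiv I f x (anchor x (σ x)) • η x + f x • bracket σ η x

/-- Fields of alternating `p`-linear forms on the fibres of `V` (no smoothness imposed). -/
abbrev FormField (p : ℕ) := ∀ x : M, V x [⋀^Fin p]→ₗ[ℝ] ℝ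

variable {V}

/-- A field of alternating forms is a `p`-form, that is, a smooth section of `⋀^p V*`, when its
values on smooth sections are smooth functions. -/
def FormField.IsSmooth {p : ℕ} (θ : FormField V p) : Prop :=
  ∀ σ : Fin p → Cₛ^∞⟮I; F, V⟯, ContMDiff I 𝓘(ℝ, ℝ) ∞ (fun x => θ x (fun i => σ i x))

variable {I F}
variable [IsManifold I ∞ M]

/-- The terms `(-1)^(i+j) θ([σ i, σ j], …, σ i omitted, …, σ j omitted, …)`, `i < j`, of the exterior
differential.  For `p = 0` there are none. For `p = k + 1` the pairs `i < j` in `Fin (k + 2)` are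
`(i.castSucc, j.succ)` with `i ≤ j` in `Fin (k + 1)`. -/
def LieAlgebroid.dBracketTerms (A : LieAlgebroid I F V) :
    ∀ {p : ℕ}, FormField V p → (Fin (p + 1) → Cₛ^∞⟮I; F, V⟯) → M → ℝ
  | 0, _, _, _ => 0
  | k + 1, θ, σ, x =>
      ∑ i : Fin (k + 1), ∑ j ∈ Finset.Ici i, (-1) ^ ((i.castSucc : ℕ) + (j.succ : ℕ)) *
        θ x (Matrix.vecCons (A.bracket (σ i.castSucc) (σ j.succ) x)
          (j.removeNth (i.castSucc.removeNth (fun l => σ l x))))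

/-- The exterior differential `dθ` of a `p`-form, evaluated on `p + 1` smooth sections:
`∑ i, (-1)^i ρ(σ i)(θ(σ 0, …, σ i omitted, …, σ p))`
`+ ∑ i < j, (-1)^(i+j) θ([σ i, σ j], …, σ i omitted, …, σ j omitted, …)`. -/
def LieAlgebroid.d (A : LieAlgebroid I F V) {p : ℕ} (θ : FormField V p)
    (σ : Fin (p + 1) → Cₛ^∞⟮I; F, V⟯) (x : M) : ℝ :=
  (∑ i : Fin (p + 1), (-1) ^ (i : ℕ) *
      mvfderiv I (fun y => θ y (i.removeNth (fun l => σ l y))) x (A.anchor x (σ i x)))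
    + A.dBracketTerms θ σ x

/-- A curve `a : [t₀, t₁] → V` is an `E`-path when it is `C¹` and its base curve `γ = τ ∘ a`
satisfies `γ' = ρ ∘ a` on `[t₀, t₁]` (one-sided derivatives at the end points).  The base curve is
then automatically `C²`. -/
structure LieAlgebroid.IsPath (A : LieAlgebroid I F V) (t₀ t₁ : ℝ) (a : ℝ → TotalSpace F V) :
    Prop where
  contMDiffOn : ContMDiffOn 𝓘(ℝ, ℝ) (I.prod 𝓘(ℝ, F)) 1 a (Icc t₀ t₁)
  admissible : ∀ t ∈ Icc t₀ t₁,
    HasMFDerivWithinAt 𝓘(ℝ, ℝ) I (fun s => (a s).proj) (Icc t₀ t₁) t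
      ((1 : ℝ →L[ℝ] ℝ).smulRight (A.anchor (a t).proj (a t).2))

section LagrangeEquations

variable (A : LieAlgebroid I F V) (L : TotalSpace F V → ℝ)

/-- `∂L/∂y^α` at `v`, where `y` are the linear fibre coordinates of a local basis of sections whose
`α`-th member is `e`. -/
def fibreDeriv (e : Cₛ^∞⟮I; F, V⟯) (v : TotalSpace F V) : ℝ :=
  deriv (fun s : ℝ => L ⟨v.proj, v.2 + s • e v.proj⟩) 0

variable {ι : Type*} [Fintype ι] {e : ι → Cₛ^∞⟮I; F, V⟯} {u : Set M}
  (he : IsLocalFrameOn I F ∞ (fun α x => e α x) u)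

/-- The structure functions `C^γ_{αβ}` of the local basis `e`: `[e_α, e_β] = C^γ_{αβ} e_γ`. -/
def LieAlgebroid.structureFun (α β γ : ι) (x : M) : ℝ :=
  he.coeff γ x (A.bracket (e α) (e β) x)

/-- `ρ^i_α ∂L/∂x^i` at `v`, in the fibred coordinates `(x, y)` of the local basis `e`: the partial
derivative of `L(x, y) = L(∑ y^β e_β(x))` with respect to `x`, with `y` kept fixed at the
coordinates of `v`, in the direction `ρ(e_α) = ρ^i_α ∂/∂x^i`. -/
def LieAlgebroid.baseDeriv (α : ι) (v : TotalSpace F V) : ℝ :=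
  mvfderiv I (fun x => L ⟨x, ∑ β, he.coeff β v.proj v.2 • e β x⟩) v.proj
    (A.anchor v.proj (e α v.proj))

end LagrangeEquations

/-- `a : [t₀, t₁] → V` is a solution of Lagrange's equations for `L`: it is an `E`-path (which is
`dx^i/dt = ρ^i_α y^α`), and, for every local basis of sections `e` (over an open set `u`, by smooth
sections of `V`) and every `t` with `τ(a(t)) ∈ u`,
`d/dt (∂L/∂y^α) + ∂L/∂y^γ C^γ_{αβ} y^β - ρ^i_α ∂L/∂x^i = 0` along `a` at `t`.

The sections `e α` are globally defined; every local basis of sections coincides near each point of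
its domain with one of this kind. -/
structure LieAlgebroid.SolvesLagrange (A : LieAlgebroid I F V) (L : TotalSpace F V → ℝ)
    (t₀ t₁ : ℝ) (a : ℝ → TotalSpace F V) : Prop where
  isPath : A.IsPath t₀ t₁ a
  lagrange : ∀ (u : Set M), IsOpen u → ∀ (e : Fin (Module.finrank ℝ F) → Cₛ^∞⟮I; F, V⟯)
    (he : IsLocalFrameOn I F ∞ (fun α x => e α x) u),
    ∀ t ∈ Icc t₀ t₁, (a t).proj ∈ u → ∀ α, ∃ p' : ℝ,
      HasDerivWithinAt (fun s => fibreDeriv L (e α) (a s)) p' (Icc t₀ t₁) t ∧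
      p' + (∑ γ, ∑ β, fibreDeriv L (e γ) (a t) * A.structureFun he α β γ (a t).proj *
          he.coeff β (a t).proj (a t).2)
        - A.baseDeriv L he α (a t) = 0

end LieAlgebroids

section Morphisms

variable {EM : Type*} [NormedAddCommGroup EM] [NormedSpace ℝ EM]
  {H : Type*} [TopologicalSpace H] (I : ModelWithCorners ℝ EM H)
  {M : Type*} [TopologicalSpace M] [ChartedSpace H M]
  (F : Type*) [NormedAddCommGroup F] [NormedSpace ℝ F]
  (V : M → Type*) [TopologicalSpace (TotalSpace F V)]
  [∀ x, AddCommGroup (V x)] [∀ x, Module ℝ (V x)] [∀ x, TopologicalSpace (V x)]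
  [FiberBundle F V] [VectorBundle ℝ F V]
  {EM' : Type*} [NormedAddCommGroup EM'] [NormedSpace ℝ EM']
  {H' : Type*} [TopologicalSpace H'] (I' : ModelWithCorners ℝ EM' H')
  {M' : Type*} [TopologicalSpace M'] [ChartedSpace H' M']
  (F' : Type*) [NormedAddCommGroup F'] [NormedSpace ℝ F']
  (V' : M' → Type*) [TopologicalSpace (TotalSpace F' V')]
  [∀ x, AddCommGroup (V' x)] [∀ x, Module ℝ (V' x)] [∀ x, TopologicalSpace (V' x)]
  [FiberBundle F' V'] [VectorBundle ℝ F' V']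

/-- A smooth vector bundle map `Φ : V → V'` over a smooth map `φ : M → M'`. -/
structure SmoothBundleMap where
  base : M → M'
  fibre : ∀ x : M, V x →ₗ[ℝ] V' (base x)
  contMDiff_base : ContMDiff I I' ∞ base
  contMDiff_total : ContMDiff (I.prod 𝓘(ℝ, F)) (I'.prod 𝓘(ℝ, F')) ∞
    (fun v : TotalSpace F V => (⟨base v.proj, fibre v.proj v.2⟩ : TotalSpace F' V'))

variable {I F V I' F' V'}

/-- The map of total spaces. -/
def SmoothBundleMap.total (Φ : SmoothBundleMap I F V I' F' V') (v : TotalSpace F V) :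
    TotalSpace F' V' :=
  ⟨Φ.base v.proj, Φ.fibre v.proj v.2⟩

/-- The pullback `Φ*θ`, `(Φ*θ)_x(v₁, …, v_p) = θ_{φ(x)}(Φ v₁, …, Φ v_p)`. -/
def SmoothBundleMap.pullback (Φ : SmoothBundleMap I F V I' F' V') {p : ℕ} (θ : FormField V' p) :
    FormField V p :=
  fun x => (θ (Φ.base x)).compLinearMap (Φ.fibre x)

/-- `Φ` is a morphism of Lie algebroids: `Φ* dθ = d Φ* θ` for every `p` and every `p`-form `θ` on
`V'`.  The two sides are compared at a point `x` on the values at `x` of sections `σ i` of `V`;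
the left side, `(dθ)_{φ(x)}(Φ (σ 0 x), …, Φ (σ p x))`, is computed by means of sections `σ' i` of
`V'` with the values `Φ (σ i x)` at `φ x` (it does not depend on their choice). -/
def SmoothBundleMap.IsMorphism [IsManifold I ∞ M] [IsManifold I' ∞ M']
    (Φ : SmoothBundleMap I F V I' F' V') (A : LieAlgebroid I F V) (A' : LieAlgebroid I' F' V') :
    Prop :=
  ∀ (p : ℕ) (θ : FormField V' p), θ.IsSmooth I' F' →
    ∀ (x : M) (σ : Fin (p + 1) → Cₛ^∞⟮I; F, V⟯) (σ' : Fin (p + 1) → Cₛ^∞⟮I'; F', V'⟯),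
      (∀ i, σ' i (Φ.base x) = Φ.fibre x (σ i x)) →
        A'.d θ σ' (Φ.base x) = A.d (Φ.pullback θ) σ x

end Morphisms

end

/-! ### Algebra of the Euler–Lagrange expressions -/

noncomputable section

/-! Write `Φ e_β = Φ^μ_β e'_μ` near a point of the path, and let `δL_α` be the left side of
Lagrange's equation in the frame `e`. The claim is that `δL_α = Φ^μ_α δL'_μ` along `a`, so the
equations for `L'` force those for `L`, with no invertibility of `Φ` needed.

Since `Φ` is linear on fibres, `∂L/∂y^α = Φ^μ_α ∂L'/∂y'^μ` (`fibreDeriv_comp_total`). Its time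
derivative involves `y^β ρ(e_β)Φ^μ_α`, because the base velocity is `ρ(a)`. The base derivative of
`L` involves `y^β ρ(e_α)Φ^μ_β`, because freezing `y` does not freeze `y'^μ = y^β Φ^μ_β`
(`baseDeriv_comp_total`).

The difference of these two unwanted terms is what the morphism condition supplies. In degree 0 it
says that `Φ` intertwines the anchors. In degree 1, on a dual coframe of `e'`, it expresses `Φ^μ_γ
C^γ_{αβ}` through `ρ(e_α)Φ^μ_β - ρ(e_β)Φ^μ_α` and the structure functions of `e'`
(`structure_equation`). `lagrange_change_of_frame` performs the cancellation. -/

/-- Everything is evaluated at one time, with `α` fixed: `P μ β` is `Φ^μ_β`, `R β μ γ` is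
`ρ(e_β)Φ^μ_γ`, `C β γ` is `C^γ_{αβ}`, `D` is `∂L'/∂y'`, `p'` its time derivative, and `B`, `B'` are
the base derivatives of the two Lagrangians. -/
theorem lagrange_change_of_frame {ι κ : Type*} [Fintype ι] [Fintype κ] (α : ι)
    (P : κ → ι → ℝ) (R : ι → κ → ι → ℝ) (C : ι → ι → ℝ) (C' : κ → κ → κ → ℝ)
    (D p' B' y' : κ → ℝ) (y : ι → ℝ) (B : ℝ)
    (hL : ∀ μ, p' μ + (∑ ν, ∑ l, D ν * C' μ l ν * y' l) - B' μ = 0)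
    (hC : ∀ μ β, ∑ γ, P μ γ * C β γ
      = R α μ β - R β μ α + ∑ ν, ∑ l, P ν α * P l β * C' ν l μ)
    (hy : ∀ μ, y' μ = ∑ β, y β * P μ β)
    (hB : B = ∑ μ, P μ α * B' μ + ∑ μ, (∑ β, y β * R α μ β) * D μ) :
    (∑ μ, ((∑ β, y β * R β μ α) * D μ + P μ α * p' μ))
      + (∑ γ, ∑ β, (∑ μ, P μ γ * D μ) * C β γ * y β) - B = 0 := by
  have h1 : (∑ γ, ∑ β, (∑ μ, P μ γ * D μ) * C β γ * y β)
      = ∑ μ, D μ * ∑ β, y β * ∑ γ, P μ γ * C β γ := by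
    simp only [Finset.sum_mul, Finset.mul_sum]
    rw [Finset.sum_comm]
    rw [Finset.sum_congr rfl fun β _ => Finset.sum_comm]
    rw [Finset.sum_comm]
    refine Finset.sum_congr rfl fun μ _ => Finset.sum_congr rfl fun β _ =>
      Finset.sum_congr rfl fun γ _ => by ring
  have h2 : ∀ μ, ∑ β, y β * ∑ γ, P μ γ * C β γ
      = ∑ β, y β * R α μ β - ∑ β, y β * R β μ α + ∑ ν, P ν α * ∑ l, C' ν l μ * y' l := by
    intro μ
    simp only [hC, mul_add, mul_sub, Finset.sum_add_distrib, Finset.sum_sub_distrib]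
    congr 1
    simp only [hy, Finset.mul_sum]
    rw [Finset.sum_comm]
    refine Finset.sum_congr rfl fun ν _ => ?_
    rw [Finset.sum_comm]
    exact Finset.sum_congr rfl fun l _ => Finset.sum_congr rfl fun β _ => by ring
  have h3 : ∑ μ, P μ α * p' μ = ∑ μ, P μ α * B' μ
      - ∑ μ, D μ * ∑ ν, P ν α * ∑ l, C' ν l μ * y' l := by
    have : ∀ μ, p' μ = B' μ - ∑ ν, ∑ l, D ν * C' μ l ν * y' l := fun μ => by linarith [hL μ]
    simp only [this, mul_sub, Finset.sum_sub_distrib, Finset.mul_sum]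
    congr 1
    rw [Finset.sum_comm]
    exact Finset.sum_congr rfl fun l _ => Finset.sum_congr rfl fun β _ =>
      Finset.sum_congr rfl fun _ _ => by ring
  -- The terms in `R α` cancel against `B`, those in `R β` against the time derivative of `P`, and
  -- those in `C'` against the ones brought in by `h3`.
  rw [h1, hB, Finset.sum_add_distrib, h3]
  simp only [h2, mul_add, mul_sub, Finset.sum_add_distrib, Finset.sum_sub_distrib]
  have h4 : ∀ S : κ → ℝ, ∑ μ, S μ * D μ = ∑ μ, D μ * S μ := fun S =>
    Finset.sum_congr rfl fun _ _ => mul_comm _ _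
  rw [h4, h4]
  ring

/-! ### Smooth frames and coframes -/

section

variable {EM : Type*} [NormedAddCommGroup EM] [NormedSpace ℝ EM]
  {H : Type*} [TopologicalSpace H] {I : ModelWithCorners ℝ EM H}
  {M : Type*} [TopologicalSpace M] [ChartedSpace H M]
  {F : Type*} [NormedAddCommGroup F] [NormedSpace ℝ F]
  {V : M → Type*} [TopologicalSpace (TotalSpace F V)]
  [∀ x, AddCommGroup (V x)] [∀ x, Module ℝ (V x)] [∀ x, TopologicalSpace (V x)]
  [FiberBundle F V] [VectorBundle ℝ F V]

/-- Composed with this map, a Lagrangian becomes a smooth function of the base point and the fibre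
coordinates. -/
theorem contMDiff_sum_smul_section [IsManifold I ∞ M] [ContMDiffVectorBundle ∞ F V I]
    {ι : Type*} [Fintype ι] (e : ι → Cₛ^∞⟮I; F, V⟯) :
    ContMDiff (I.prod 𝓘(ℝ, ι → ℝ)) (I.prod 𝓘(ℝ, F)) ∞
      (fun q : M × (ι → ℝ) => (⟨q.1, ∑ i, q.2 i • e i q.1⟩ : TotalSpace F V)) := by
  rintro ⟨x, c⟩
  set T := trivializationAt F V x with hT
  have hx : x ∈ T.baseSet := FiberBundle.mem_baseSet_trivializationAt' x
  rw [T.contMDiffAt_iff (by rwa [T.mem_source])]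
  refine ⟨contMDiffAt_fst, ?_⟩
  have h : ContMDiffAt (I.prod 𝓘(ℝ, ι → ℝ)) 𝓘(ℝ, F) ∞
      (fun q : M × (ι → ℝ) => ∑ i, q.2 i • (T ⟨q.1, e i q.1⟩).2) (x, c) := by
    refine ContMDiffAt.sum fun i _ => ?_
    have h1 : ContMDiffAt (I.prod 𝓘(ℝ, ι → ℝ)) 𝓘(ℝ, ℝ) ∞
        (fun q : M × (ι → ℝ) => q.2 i) (x, c) :=
      (contMDiff_pi_space.1 (contMDiff_snd (I := I) (M := M)) i).contMDiffAt
    have h2 : ContMDiffAt (I.prod 𝓘(ℝ, ι → ℝ)) 𝓘(ℝ, F) ∞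
        (fun q : M × (ι → ℝ) => (T ⟨q.1, e i q.1⟩).2) (x, c) :=
      ContMDiffAt.comp (g := fun z => (T ⟨z, e i z⟩).2) (f := Prod.fst) (x, c)
        ((T.contMDiffAt_section_iff hx).1 (e i).contMDiff.contMDiffAt) contMDiffAt_fst
    exact h1.smul h2
  refine h.congr_of_eventuallyEq ?_
  have : ∀ᶠ q : M × (ι → ℝ) in nhds (x, c), q.1 ∈ T.baseSet :=
    continuous_fst.continuousAt.eventually (T.open_baseSet.mem_nhds hx)
  filter_upwards [this] with q hq
  have hl : ∀ v : V q.1, (T ⟨q.1, v⟩).2 = T.linearEquivAt ℝ q.1 hq v := fun v => by simp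
  simp only [hl, map_sum, map_smul]

/-- Brackets and the morphism condition see only global sections and forms, so a trivialization's
frame and its dual coframe are both cut off by a bump function `χ`. They remain dual where `χ = 1`.
-/
theorem exists_global_frame [T2Space M] [FiniteDimensional ℝ EM] [IsManifold I ∞ M]
    [ContMDiffVectorBundle ∞ F V I] [FiniteDimensional ℝ F] (x : M) :
    ∃ (u : Set M) (e : Fin (Module.finrank ℝ F) → Cₛ^∞⟮I; F, V⟯)
      (he : IsLocalFrameOn I F ∞ (fun α x => e α x) u)
      (θ : Fin (Module.finrank ℝ F) → ∀ x, V x →ₗ[ℝ] ℝ), IsOpen u ∧ x ∈ u ∧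
      (∀ α, ContMDiff (I.prod 𝓘(ℝ, F)) 𝓘(ℝ, ℝ) ∞ (fun v : TotalSpace F V => θ α v.proj v.2)) ∧
      ∀ α, ∀ z ∈ u, θ α z = he.coeff α z := by
  set T := trivializationAt F V x with hT
  have hx : x ∈ T.baseSet := FiberBundle.mem_baseSet_trivializationAt' x
  let b := Module.finBasis ℝ F
  obtain ⟨χ, -, hχ⟩ := (SmoothBumpFunction.nhds_basis_tsupport (I := I) x).mem_iff.1
    (T.open_baseSet.mem_nhds hx)
  obtain ⟨u, hu1, huo, hxu⟩ := eventually_nhds_iff.1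
    (χ.eventuallyEq_one.and (T.open_baseSet.mem_nhds hx))
  have huT : u ⊆ T.baseSet := fun z hz => (hu1 z hz).2
  let e : Fin (Module.finrank ℝ F) → Cₛ^∞⟮I; F, V⟯ := fun α =>
    ⟨fun z => χ z • T.localFrame b α z,
      ContMDiffOn.smul_section_of_tsupport χ.contMDiff.contMDiffOn T.open_baseSet hχ
        (T.contMDiffOn_localFrame_baseSet ∞ b α)⟩
  have heq : ∀ α, ∀ z ∈ u, T.localFrame b α z = e α z := fun α z hz => by
    change _ = χ z • T.localFrame b α z
    rw [(hu1 z hz).1]; simp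
  have h0 := (T.isLocalFrameOn_localFrame_baseSet I ∞ b).mono huT
  have he : IsLocalFrameOn I F ∞ (fun α x => e α x) u := h0.congr heq
  let θ : Fin (Module.finrank ℝ F) → ∀ x, V x →ₗ[ℝ] ℝ := fun α z =>
    χ z • (b.coord α ∘ₗ (T.linearMapAt ℝ z))
  refine ⟨u, e, he, θ, huo, hxu, fun α => ?_, fun α z hz => ?_⟩
  · have hO : IsOpen (TotalSpace.proj ⁻¹' T.baseSet : Set (TotalSpace F V)) :=
      T.open_baseSet.preimage (FiberBundle.continuous_proj F V)
    have hsub : tsupport (fun v : TotalSpace F V => θ α v.proj v.2)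
        ⊆ TotalSpace.proj ⁻¹' tsupport χ := by
      refine closure_minimal (fun v hv => subset_closure ?_)
        ((isClosed_tsupport χ).preimage (FiberBundle.continuous_proj F V))
      exact fun h => hv (by simp [θ, h])
    -- Smoothness needs checking only over the support of `χ`, which lies where the trivialization
    -- is defined.
    refine contMDiff_of_tsupport fun v hv => ?_
    have hv' : v.proj ∈ T.baseSet := hχ (hsub hv)
    have h1 : ContMDiffAt (I.prod 𝓘(ℝ, F)) 𝓘(ℝ, ℝ) ∞
        (fun w : TotalSpace F V => χ w.proj • b.coord α (T w).2) v := by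
      refine ContMDiffAt.smul (χ.contMDiffAt.comp v (contMDiff_proj V).contMDiffAt) ?_
      have h2 := ((T.contMDiffAt_iff (f := (id : TotalSpace F V → _)) (x₀ := v) (n := ∞)
        (IM := I.prod 𝓘(ℝ, F)) (IB := I) (by simpa [T.mem_source] using hv')).1
          contMDiffAt_id).2
      exact ((b.coord α).toContinuousLinearMap.contMDiff.contMDiffAt).comp v h2
    refine h1.congr_of_eventuallyEq ?_
    filter_upwards [hO.mem_nhds hv'] with w hw
    simp only [θ, LinearMap.smul_apply, LinearMap.comp_apply]
    rw [T.coe_linearMapAt_of_mem hw]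
  · have : ∀ v : V z, θ α z v = he.coeff α z v := by
      intro v
      have hb : he.toBasisAt hz = T.basisAt b (huT hz) := by
        ext j
        simp only [IsLocalFrameOn.toBasisAt_coe, ← heq j z hz]
        exact T.localFrame_apply_of_mem_baseSet b (huT hz)
      simp only [IsLocalFrameOn.coeff, hz, dif_pos, hb]
      simp [θ, (hu1 z hz).1, Bundle.Trivialization.basisAt]
      rw [T.coe_linearMapAt_of_mem (huT hz)]
    exact LinearMap.ext this

end

/-! ### Chain rules on manifolds -/

section

variable {EM : Type*} [NormedAddCommGroup EM] [NormedSpace ℝ EM]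
  {H : Type*} [TopologicalSpace H] {I : ModelWithCorners ℝ EM H}
  {M : Type*} [TopologicalSpace M] [ChartedSpace H M]
  {EM' : Type*} [NormedAddCommGroup EM'] [NormedSpace ℝ EM']
  {H' : Type*} [TopologicalSpace H'] {I' : ModelWithCorners ℝ EM' H'}
  {M' : Type*} [TopologicalSpace M'] [ChartedSpace H' M']
  {W : Type*} [NormedAddCommGroup W] [NormedSpace ℝ W]

/-- Separates the motion of the base point, with coefficients frozen at `c x`, from the motion of
the coefficients over the fixed point `φ x`. -/
theorem mvfderiv_comp_prodMk {g : M' × W → ℝ} {φ : M → M'} {c : M → W} {x : M}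
    (hg : MDifferentiableAt (I'.prod 𝓘(ℝ, W)) 𝓘(ℝ, ℝ) g (φ x, c x))
    (hφ : MDifferentiableAt I I' φ x) (hc : MDifferentiableAt I 𝓘(ℝ, W) c x)
    (v : TangentSpace I x) :
    mvfderiv I (fun z => g (φ z, c z)) x v
      = mvfderiv I (fun z => g (φ z, c x)) x v
        + fderiv ℝ (fun w => g (φ x, w)) (c x) (mvfderiv I c x v) := by
  have hh : MDifferentiableAt (I.prod 𝓘(ℝ, W)) 𝓘(ℝ, ℝ) (fun q : M × W => g (φ q.1, q.2))
      (x, c x) := by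
    refine MDifferentiableAt.comp (g := g) (f := fun q : M × W => (φ q.1, q.2)) (x, c x) hg ?_
    exact (MDifferentiableAt.comp (g := φ) (f := Prod.fst) (x, c x) hφ
      mdifferentiableAt_fst).prodMk mdifferentiableAt_snd
  have h1 := mfderiv_comp_apply (g := fun q : M × W => g (φ q.1, q.2)) (f := fun z => (z, c z))
    x hh (mdifferentiableAt_id.prodMk hc) v
  have hp : mfderiv I (I.prod 𝓘(ℝ, W)) (fun z => (z, c z)) x v
      = ((v, mfderiv I 𝓘(ℝ, W) c x v) : TangentSpace (I.prod 𝓘(ℝ, W)) (x, c x)) := by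
    have := mfderiv_prodMk (mdifferentiableAt_id (I := I) (x := x)) hc
    rw [mfderiv_id] at this
    exact congrArg (fun l => l v) this
  rw [hp] at h1
  have h2 : mfderiv (I.prod 𝓘(ℝ, W)) 𝓘(ℝ, ℝ) (fun q : M × W => g (φ q.1, q.2)) (x, c x)
        ((v, mfderiv I 𝓘(ℝ, W) c x v) : TangentSpace (I.prod 𝓘(ℝ, W)) (x, c x))
      = mfderiv I 𝓘(ℝ, ℝ) (fun z => g (φ z, c x)) x v
        + mfderiv 𝓘(ℝ, W) 𝓘(ℝ, ℝ) (fun w => g (φ x, w)) (c x) (mfderiv I 𝓘(ℝ, W) c x v) :=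
    mfderiv_prod_eq_add_apply hh
  rw [mfderiv_eq_fderiv] at h2
  exact h1.trans h2

theorem hasDerivWithinAt_comp_mvfderiv {f : M → W} {γ : ℝ → M} {s : Set ℝ} {t : ℝ}
    {w : TangentSpace I (γ t)} (hf : MDifferentiableAt I 𝓘(ℝ, W) f (γ t))
    (hγ : HasMFDerivWithinAt 𝓘(ℝ, ℝ) I γ s t ((1 : ℝ →L[ℝ] ℝ).smulRight w)) :
    HasDerivWithinAt (fun r => f (γ r)) (mvfderiv I f (γ t) w) s t := by
  have h := (hf.hasMFDerivAt.comp_hasMFDerivWithinAt t hγ).hasFDerivWithinAt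
  refine HasFDerivWithinAt.congr_fderiv h ?_
  refine ContinuousLinearMap.ext fun (r : ℝ) => ?_
  exact map_smul (mvfderiv I f (γ t)) r w

end

/-! ### The exterior differential in degrees 0 and 1 -/

section

variable {EM : Type*} [NormedAddCommGroup EM] [NormedSpace ℝ EM]
  {H : Type*} [TopologicalSpace H] {I : ModelWithCorners ℝ EM H}
  {M : Type*} [TopologicalSpace M] [ChartedSpace H M] [IsManifold I ∞ M]
  {F : Type*} [NormedAddCommGroup F] [NormedSpace ℝ F]
  {V : M → Type*} [TopologicalSpace (TotalSpace F V)]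
  [∀ x, AddCommGroup (V x)] [∀ x, Module ℝ (V x)] [∀ x, TopologicalSpace (V x)]
  [FiberBundle F V] [VectorBundle ℝ F V]

theorem LieAlgebroid.d_constOfIsEmpty (A : LieAlgebroid I F V) (f : M → ℝ)
    (σ : Fin 1 → Cₛ^∞⟮I; F, V⟯) (x : M) :
    A.d (fun z => AlternatingMap.constOfIsEmpty ℝ (V z) (Fin 0) (f z)) σ x
      = mvfderiv I f x (A.anchor x (σ 0 x)) := by
  simp [LieAlgebroid.d, LieAlgebroid.dBracketTerms]

theorem LieAlgebroid.d_ofSubsingleton (A : LieAlgebroid I F V) (θ : ∀ x, V x →ₗ[ℝ] ℝ)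
    (σ η : Cₛ^∞⟮I; F, V⟯) (x : M) :
    A.d (fun z => AlternatingMap.ofSubsingleton ℝ (V z) ℝ (0 : Fin 1) (θ z)) ![σ, η] x
      = mvfderiv I (fun z => θ z (η z)) x (A.anchor x (σ x))
        - mvfderiv I (fun z => θ z (σ z)) x (A.anchor x (η x))
        - θ x (A.bracket σ η x) := by
  simp [LieAlgebroid.d, LieAlgebroid.dBracketTerms, Fin.sum_univ_two, Fin.removeNth]
  ring

end

/-! ### The morphism condition on functions and one-forms -/

section

variable {EM : Type*} [NormedAddCommGroup EM] [NormedSpace ℝ EM]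
  {H : Type*} [TopologicalSpace H] {I : ModelWithCorners ℝ EM H}
  {M : Type*} [TopologicalSpace M] [ChartedSpace H M] [IsManifold I ∞ M]
  {F : Type*} [NormedAddCommGroup F] [NormedSpace ℝ F]
  {V : M → Type*} [TopologicalSpace (TotalSpace F V)]
  [∀ x, AddCommGroup (V x)] [∀ x, Module ℝ (V x)] [∀ x, TopologicalSpace (V x)]
  [FiberBundle F V] [VectorBundle ℝ F V]
  {EM' : Type*} [NormedAddCommGroup EM'] [NormedSpace ℝ EM']
  {H' : Type*} [TopologicalSpace H'] {I' : ModelWithCorners ℝ EM' H'}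
  {M' : Type*} [TopologicalSpace M'] [ChartedSpace H' M'] [IsManifold I' ∞ M']
  {F' : Type*} [NormedAddCommGroup F'] [NormedSpace ℝ F']
  {V' : M' → Type*} [TopologicalSpace (TotalSpace F' V')]
  [∀ x, AddCommGroup (V' x)] [∀ x, Module ℝ (V' x)] [∀ x, TopologicalSpace (V' x)]
  [FiberBundle F' V'] [VectorBundle ℝ F' V']
  {Φ : SmoothBundleMap I F V I' F' V'} {A : LieAlgebroid I F V} {A' : LieAlgebroid I' F' V'}

/-- Degree 0 of the morphism condition: `Tφ ∘ ρ = ρ' ∘ Φ`, tested on functions. -/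
theorem SmoothBundleMap.IsMorphism.mvfderiv_comp_base (hΦ : Φ.IsMorphism A A') {f : M' → ℝ}
    (hf : ContMDiff I' 𝓘(ℝ, ℝ) ∞ f) (x : M) (σ : Cₛ^∞⟮I; F, V⟯) (σ' : Cₛ^∞⟮I'; F', V'⟯)
    (h : σ' (Φ.base x) = Φ.fibre x (σ x)) :
    mvfderiv I (fun z => f (Φ.base z)) x (A.anchor x (σ x))
      = mvfderiv I' f (Φ.base x) (A'.anchor (Φ.base x) (σ' (Φ.base x))) := by
  have := hΦ 0 (fun z => AlternatingMap.constOfIsEmpty ℝ (V' z) (Fin 0) (f z))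
    (fun _ => by simpa using hf) x (fun _ => σ) (fun _ => σ') (fun _ => h)
  rw [A'.d_constOfIsEmpty] at this
  rw [this]
  exact (A.d_constOfIsEmpty (fun z => f (Φ.base z)) (fun _ => σ) x).symm

theorem SmoothBundleMap.IsMorphism.oneForm (hΦ : Φ.IsMorphism A A') (θ : ∀ x, V' x →ₗ[ℝ] ℝ)
    (hθ : ∀ σ' : Cₛ^∞⟮I'; F', V'⟯, ContMDiff I' 𝓘(ℝ, ℝ) ∞ (fun z => θ z (σ' z)))
    (x : M) (σ η : Cₛ^∞⟮I; F, V⟯) (σ' η' : Cₛ^∞⟮I'; F', V'⟯)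
    (hσ : σ' (Φ.base x) = Φ.fibre x (σ x)) (hη : η' (Φ.base x) = Φ.fibre x (η x)) :
    mvfderiv I' (fun z => θ z (η' z)) (Φ.base x) (A'.anchor _ (σ' (Φ.base x)))
        - mvfderiv I' (fun z => θ z (σ' z)) (Φ.base x) (A'.anchor _ (η' (Φ.base x)))
        - θ (Φ.base x) (A'.bracket σ' η' (Φ.base x))
      = mvfderiv I (fun z => θ (Φ.base z) (Φ.fibre z (η z))) x (A.anchor x (σ x))
        - mvfderiv I (fun z => θ (Φ.base z) (Φ.fibre z (σ z))) x (A.anchor x (η x))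
        - θ (Φ.base x) (Φ.fibre x (A.bracket σ η x)) := by
  have := hΦ 1 (fun z => AlternatingMap.ofSubsingleton ℝ (V' z) ℝ (0 : Fin 1) (θ z))
    (fun σ => by simpa using hθ (σ 0)) x ![σ, η] ![σ', η']
    (fun i => by fin_cases i <;> simp [hσ, hη])
  rw [A'.d_ofSubsingleton] at this
  rw [this]
  exact A.d_ofSubsingleton (fun z => (θ (Φ.base z)).comp (Φ.fibre z)) σ η x

omit [IsManifold I ∞ M] [VectorBundle ℝ F V] [IsManifold I' ∞ M'] [VectorBundle ℝ F' V'] in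
theorem SmoothBundleMap.contMDiff_apply_section (Φ : SmoothBundleMap I F V I' F' V')
    {g : TotalSpace F' V' → ℝ} (hg : ContMDiff (I'.prod 𝓘(ℝ, F')) 𝓘(ℝ, ℝ) ∞ g)
    (σ : Cₛ^∞⟮I; F, V⟯) :
    ContMDiff I 𝓘(ℝ, ℝ) ∞ (fun z => g ⟨Φ.base z, Φ.fibre z (σ z)⟩) :=
  hg.comp (Φ.contMDiff_total.comp σ.contMDiff)

end

/-! ### Fibre derivatives in a frame -/

section

variable {EM : Type*} [NormedAddCommGroup EM] [NormedSpace ℝ EM]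
  {H : Type*} [TopologicalSpace H] {I : ModelWithCorners ℝ EM H}
  {M : Type*} [TopologicalSpace M] [ChartedSpace H M] [IsManifold I ∞ M]
  {F : Type*} [NormedAddCommGroup F] [NormedSpace ℝ F]
  {V : M → Type*} [TopologicalSpace (TotalSpace F V)]
  [∀ x, AddCommGroup (V x)] [∀ x, Module ℝ (V x)] [∀ x, TopologicalSpace (V x)]
  [FiberBundle F V] [VectorBundle ℝ F V] [ContMDiffVectorBundle ∞ F V I]
  {L : TotalSpace F V → ℝ} {ι : Type*} [Fintype ι]

theorem differentiable_comp_sum_smul (hL : ContMDiff (I.prod 𝓘(ℝ, F)) 𝓘(ℝ, ℝ) ∞ L)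
    (e : ι → Cₛ^∞⟮I; F, V⟯) (x : M) :
    Differentiable ℝ (fun w : ι → ℝ => L ⟨x, ∑ i, w i • e i x⟩) := by
  have h : ContMDiff 𝓘(ℝ, ι → ℝ) 𝓘(ℝ, ℝ) ∞ (fun w : ι → ℝ => L ⟨x, ∑ i, w i • e i x⟩) :=
    (hL.comp (contMDiff_sum_smul_section e)).comp (contMDiff_const.prodMk contMDiff_id)
  exact h.contDiff.differentiable (by simp)

theorem deriv_fibre_eq_fderiv (hL : ContMDiff (I.prod 𝓘(ℝ, F)) 𝓘(ℝ, ℝ) ∞ L)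
    (e : ι → Cₛ^∞⟮I; F, V⟯) (x : M) (c d : ι → ℝ) :
    deriv (fun s : ℝ => L ⟨x, ∑ i, c i • e i x + s • ∑ i, d i • e i x⟩) 0
      = fderiv ℝ (fun w : ι → ℝ => L ⟨x, ∑ i, w i • e i x⟩) c d := by
  have h : (fun s : ℝ => L ⟨x, ∑ i, c i • e i x + s • ∑ i, d i • e i x⟩)
      = fun s : ℝ => (fun w : ι → ℝ => L ⟨x, ∑ i, w i • e i x⟩) (c + s • d) := by
    funext s
    simp [add_smul, Finset.sum_add_distrib, Finset.smul_sum, mul_smul]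
  rw [h]
  exact (((differentiable_comp_sum_smul hL e x) c).lineDeriv_eq_fderiv (v := d))

theorem fderiv_eq_sum_fibreDeriv (hL : ContMDiff (I.prod 𝓘(ℝ, F)) 𝓘(ℝ, ℝ) ∞ L)
    (e : ι → Cₛ^∞⟮I; F, V⟯) (x : M) (c d : ι → ℝ) :
    fderiv ℝ (fun w : ι → ℝ => L ⟨x, ∑ i, w i • e i x⟩) c d
      = ∑ i, d i * fibreDeriv L (e i) ⟨x, ∑ i, c i • e i x⟩ := by
  classical
  have h : ∀ i, fibreDeriv L (e i) ⟨x, ∑ i, c i • e i x⟩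
      = fderiv ℝ (fun w : ι → ℝ => L ⟨x, ∑ i, w i • e i x⟩) c (Pi.single i 1) := fun i => by
    rw [← deriv_fibre_eq_fderiv hL]
    simp [fibreDeriv, Pi.single_apply]
  conv_lhs => rw [pi_eq_sum_univ' d]
  simp only [map_sum, map_smul, h, smul_eq_mul]

variable {u : Set M} {e : ι → Cₛ^∞⟮I; F, V⟯}

omit [IsManifold I ∞ M] [VectorBundle ℝ F V] [ContMDiffVectorBundle ∞ F V I] in
theorem IsLocalFrameOn.sum_coeff_smul (he : IsLocalFrameOn I F ∞ (fun α x => e α x) u) {x : M}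
    (hx : x ∈ u) (v : V x) : ∑ i, he.coeff i x v • e i x = v := by
  have := (he.toBasisAt hx).sum_repr v
  simpa [IsLocalFrameOn.coeff, hx] using this

omit [IsManifold I ∞ M] [VectorBundle ℝ F V] [ContMDiffVectorBundle ∞ F V I] [Fintype ι] in
theorem IsLocalFrameOn.coeff_self [DecidableEq ι]
    (he : IsLocalFrameOn I F ∞ (fun α x => e α x) u) {x : M}
    (hx : x ∈ u) (i j : ι) : he.coeff i x (e j x) = if j = i then 1 else 0 := by
  have : he.toBasisAt hx j = e j x := he.toBasisAt_coe hx j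
  rw [← this]
  simp [IsLocalFrameOn.coeff, hx, -IsLocalFrameOn.toBasisAt_coe, Finsupp.single_apply]

end

/-! ### Bundle maps and morphisms in frames -/

section

variable {EM : Type*} [NormedAddCommGroup EM] [NormedSpace ℝ EM]
  {H : Type*} [TopologicalSpace H] {I : ModelWithCorners ℝ EM H}
  {M : Type*} [TopologicalSpace M] [ChartedSpace H M] [IsManifold I ∞ M]
  {F : Type*} [NormedAddCommGroup F] [NormedSpace ℝ F]
  {V : M → Type*} [TopologicalSpace (TotalSpace F V)]
  [∀ x, AddCommGroup (V x)] [∀ x, Module ℝ (V x)] [∀ x, TopologicalSpace (V x)]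
  [FiberBundle F V] [VectorBundle ℝ F V]
  {EM' : Type*} [NormedAddCommGroup EM'] [NormedSpace ℝ EM']
  {H' : Type*} [TopologicalSpace H'] {I' : ModelWithCorners ℝ EM' H'}
  {M' : Type*} [TopologicalSpace M'] [ChartedSpace H' M'] [IsManifold I' ∞ M']
  {F' : Type*} [NormedAddCommGroup F'] [NormedSpace ℝ F']
  {V' : M' → Type*} [TopologicalSpace (TotalSpace F' V')]
  [∀ x, AddCommGroup (V' x)] [∀ x, Module ℝ (V' x)] [∀ x, TopologicalSpace (V' x)]
  [FiberBundle F' V'] [VectorBundle ℝ F' V']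
  {Φ : SmoothBundleMap I F V I' F' V'} {A : LieAlgebroid I F V} {A' : LieAlgebroid I' F' V'}
  {L : TotalSpace F V → ℝ} {L' : TotalSpace F' V' → ℝ}
  {ι κ : Type*} [Fintype ι] [Fintype κ]
  {e : ι → Cₛ^∞⟮I; F, V⟯} {u : Set M} {e' : κ → Cₛ^∞⟮I'; F', V'⟯} {u' : Set M'}
  {θ : κ → ∀ x, V' x →ₗ[ℝ] ℝ}

/-- The components `Φ^μ_β` of a bundle map, with respect to sections `e` of the source and
one-forms `θ` on the target. -/
def SmoothBundleMap.component (Φ : SmoothBundleMap I F V I' F' V')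
    (θ : κ → ∀ x, V' x →ₗ[ℝ] ℝ) (e : ι → Cₛ^∞⟮I; F, V⟯) (μ : κ) (β : ι) (x : M) : ℝ :=
  θ μ (Φ.base x) (Φ.fibre x (e β x))

omit [IsManifold I ∞ M] [IsManifold I' ∞ M'] [VectorBundle ℝ F V] [VectorBundle ℝ F' V'] in
omit [Fintype ι] [Fintype κ] in
theorem SmoothBundleMap.mdifferentiableAt_component
    (hθ : ∀ μ, ContMDiff (I'.prod 𝓘(ℝ, F')) 𝓘(ℝ, ℝ) ∞
      (fun v : TotalSpace F' V' => θ μ v.proj v.2)) (μ : κ) (β : ι) (x : M) :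
    MDifferentiableAt I 𝓘(ℝ, ℝ) (Φ.component θ e μ β) x :=
  (Φ.contMDiff_apply_section (hθ μ) (e β)).mdifferentiableAt (by simp)

omit [IsManifold I ∞ M] [IsManifold I' ∞ M'] [VectorBundle ℝ F V] [VectorBundle ℝ F' V'] in
omit [Fintype ι] in
theorem SmoothBundleMap.sum_component_smul (he' : IsLocalFrameOn I' F' ∞ (fun α x => e' α x) u')
    (hθu : ∀ μ, ∀ z ∈ u', θ μ z = he'.coeff μ z) {x : M} (hx : Φ.base x ∈ u') (β : ι) :
    ∑ μ, Φ.component θ e μ β x • e' μ (Φ.base x) = Φ.fibre x (e β x) := by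
  simp only [SmoothBundleMap.component, hθu _ _ hx]
  exact he'.sum_coeff_smul hx _

omit [IsManifold I ∞ M] [IsManifold I' ∞ M'] [VectorBundle ℝ F V] [VectorBundle ℝ F' V'] in
theorem SmoothBundleMap.fibre_sum_smul (he' : IsLocalFrameOn I' F' ∞ (fun α x => e' α x) u')
    (hθu : ∀ μ, ∀ z ∈ u', θ μ z = he'.coeff μ z) {x : M} (hx : Φ.base x ∈ u') (y : ι → ℝ) :
    Φ.fibre x (∑ β, y β • e β x)
      = ∑ μ, (∑ β, y β * Φ.component θ e μ β x) • e' μ (Φ.base x) := by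
  simp only [map_sum, map_smul, ← Φ.sum_component_smul he' hθu hx, Finset.smul_sum,
    Finset.sum_smul, mul_smul]
  exact Finset.sum_comm

omit [IsManifold I ∞ M] [VectorBundle ℝ F V] [Fintype ι] in
theorem fibreDeriv_comp_total [ContMDiffVectorBundle ∞ F' V' I']
    (hL' : ContMDiff (I'.prod 𝓘(ℝ, F')) 𝓘(ℝ, ℝ) ∞ L')
    (he' : IsLocalFrameOn I' F' ∞ (fun α x => e' α x) u')
    (hθu : ∀ μ, ∀ z ∈ u', θ μ z = he'.coeff μ z) (β : ι) {v : TotalSpace F V}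
    (hv : Φ.base v.proj ∈ u') :
    fibreDeriv (L' ∘ Φ.total) (e β) v
      = ∑ μ, Φ.component θ e μ β v.proj * fibreDeriv L' (e' μ) (Φ.total v) := by
  have h := he'.sum_coeff_smul hv (Φ.fibre v.proj v.2)
  have h1 := deriv_fibre_eq_fderiv hL' e' (Φ.base v.proj)
    (fun μ => he'.coeff μ _ (Φ.fibre v.proj v.2)) (fun μ => Φ.component θ e μ β v.proj)
  rw [fderiv_eq_sum_fibreDeriv hL', Φ.sum_component_smul he' hθu hv, h] at h1
  rw [← show (⟨Φ.base v.proj, Φ.fibre v.proj v.2⟩ : TotalSpace F' V') = Φ.total v from rfl, ← h1]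
  simp [fibreDeriv, SmoothBundleMap.total]

omit [IsManifold I ∞ M] in
theorem ContMDiffSection.sum_smul_apply (c : ι → ℝ) (x : M) :
    (∑ i, c i • e i : Cₛ^∞⟮I; F, V⟯) x = ∑ i, c i • e i x := by
  have := congrFun (map_sum (ContMDiffSection.coeAddHom I F ∞ V) (fun i => c i • e i)
    Finset.univ) x
  rw [Finset.sum_apply] at this
  exact this

omit [IsManifold I' ∞ M'] in
-- By duality on `u'` the function is the constant `c μ` near `x`.
theorem mvfderiv_coeff_sum_smul (huo : IsOpen u')
    (he' : IsLocalFrameOn I' F' ∞ (fun α x => e' α x) u')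
    (hθu : ∀ μ, ∀ z ∈ u', θ μ z = he'.coeff μ z) {x : M'} (hx : x ∈ u') (μ : κ)
    (c : κ → ℝ) : mvfderiv I' (fun z => θ μ z ((∑ ν, c ν • e' ν : Cₛ^∞⟮I'; F', V'⟯) z)) x = 0 := by
  classical
  have h : (fun z => θ μ z ((∑ ν, c ν • e' ν : Cₛ^∞⟮I'; F', V'⟯) z)) =ᶠ[nhds x] fun _ => c μ := by
    filter_upwards [huo.mem_nhds hx] with z hz
    rw [ContMDiffSection.sum_smul_apply, hθu _ _ hz, map_sum]
    simp [he'.coeff_self hz, -IsLocalFrameOn.coeff_apply_of_mem]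
  have h2 : mvfderiv I' (fun _ : M' => c μ) x = 0 := mvfderiv_const _
  rw [← h2]
  simp only [mvfderiv, h.mfderiv_eq]
  rfl

/-- This is `Φ* dθ^μ = d Φ* θ^μ` evaluated on `e_α, e_β`. -/
theorem SmoothBundleMap.IsMorphism.structure_equation (hΦ : Φ.IsMorphism A A')
    (he : IsLocalFrameOn I F ∞ (fun α x => e α x) u) (huo : IsOpen u')
    (he' : IsLocalFrameOn I' F' ∞ (fun α x => e' α x) u')
    (hθ : ∀ μ, ContMDiff (I'.prod 𝓘(ℝ, F')) 𝓘(ℝ, ℝ) ∞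
      (fun v : TotalSpace F' V' => θ μ v.proj v.2))
    (hθu : ∀ μ, ∀ z ∈ u', θ μ z = he'.coeff μ z) {x : M} (hxu : x ∈ u) (hx : Φ.base x ∈ u')
    (α β : ι) (μ : κ) :
    ∑ γ, Φ.component θ e μ γ x * A.structureFun he α β γ x
      = mvfderiv I (Φ.component θ e μ β) x (A.anchor x (e α x))
        - mvfderiv I (Φ.component θ e μ α) x (A.anchor x (e β x))
        + ∑ ν, ∑ l, Φ.component θ e ν α x * Φ.component θ e l β x
          * A'.structureFun he' ν l μ (Φ.base x) := by
  -- The extension of `Φ (e_β x)` has coefficients frozen at `x`. Then `θ^μ` is locally constant on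
  -- it, so on the target only the bracket term of `dθ^μ` survives, and that bracket is bilinear
  -- over constants.
  have hs : ∀ β, (∑ ν, Φ.component θ e ν β x • e' ν : Cₛ^∞⟮I'; F', V'⟯) (Φ.base x)
      = Φ.fibre x (e β x) := fun β => by
    rw [ContMDiffSection.sum_smul_apply, Φ.sum_component_smul he' hθu hx]
  have h := hΦ.oneForm (θ μ) (fun σ' => (hθ μ).comp σ'.contMDiff) x (e α) (e β) _ _ (hs α) (hs β)
  rw [mvfderiv_coeff_sum_smul huo he' hθu hx, mvfderiv_coeff_sum_smul huo he' hθu hx] at h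
  have h1 : θ μ (Φ.base x) (A'.bracket (∑ ν, Φ.component θ e ν α x • e' ν)
      (∑ ν, Φ.component θ e ν β x • e' ν) (Φ.base x))
      = ∑ ν, ∑ l, Φ.component θ e ν α x * Φ.component θ e l β x
          * A'.structureFun he' ν l μ (Φ.base x) := by
    have hb : A'.bracket (∑ ν, Φ.component θ e ν α x • e' ν) (∑ ν, Φ.component θ e ν β x • e' ν)
        = ∑ ν, Φ.component θ e ν α x • ∑ l, Φ.component θ e l β x • A'.bracket (e' ν) (e' l) := by
      simp only [map_sum, map_smul, LinearMap.sum_apply, LinearMap.smul_apply, Finset.smul_sum]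
      rw [Finset.sum_comm]
      exact Finset.sum_congr rfl fun _ _ => Finset.sum_congr rfl fun _ _ => smul_comm _ _ _
    rw [hb, ContMDiffSection.sum_smul_apply, map_sum]
    refine Finset.sum_congr rfl fun ν _ => ?_
    rw [ContMDiffSection.sum_smul_apply, map_smul, map_sum, smul_eq_mul, Finset.mul_sum]
    refine Finset.sum_congr rfl fun l _ => ?_
    rw [map_smul, smul_eq_mul, hθu _ _ hx, LieAlgebroid.structureFun, mul_assoc]
  have h2 : θ μ (Φ.base x) (Φ.fibre x (A.bracket (e α) (e β) x))
      = ∑ γ, Φ.component θ e μ γ x * A.structureFun he α β γ x := by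
    conv_lhs => rw [← he.sum_coeff_smul hxu (A.bracket (e α) (e β) x)]
    simp only [map_sum, map_smul, smul_eq_mul]
    exact Finset.sum_congr rfl fun _ _ => mul_comm _ _
  rw [h1, h2] at h
  have h3 : mvfderiv I (fun z => θ μ (Φ.base z) (Φ.fibre z (e β z))) x (A.anchor x (e α x))
      = mvfderiv I (Φ.component θ e μ β) x (A.anchor x (e α x)) := rfl
  have h4 : mvfderiv I (fun z => θ μ (Φ.base z) (Φ.fibre z (e α z))) x (A.anchor x (e β x))
      = mvfderiv I (Φ.component θ e μ α) x (A.anchor x (e β x)) := rfl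
  rw [h3, h4] at h
  simp only [_root_.zero_apply] at h
  linarith

omit [IsManifold I ∞ M] in
theorem hasMFDerivAt_pi_sum_mul {P : κ → ι → M → ℝ} {x : M}
    (hP : ∀ μ β, MDifferentiableAt I 𝓘(ℝ, ℝ) (P μ β) x) (y : ι → ℝ) :
    HasMFDerivAt I 𝓘(ℝ, κ → ℝ) (fun z μ => ∑ β, y β * P μ β z) x
      (ContinuousLinearMap.pi fun μ => ∑ β, y β • mvfderiv I (P μ β) x) := by
  refine ⟨continuousAt_pi.2 fun μ => tendsto_finsetSum _ fun β _ =>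
    (hP μ β).continuousAt.const_mul _, ?_⟩
  refine hasFDerivWithinAt_pi.2 fun μ => HasFDerivWithinAt.fun_sum fun β _ => ?_
  exact HasFDerivWithinAt.const_mul (hP μ β).hasMFDerivAt.2 (y β)

/-- With `y` frozen, `Φ` sends `y^β e_β(z)` to the point over `φ(z)` with coordinates `c^μ(z) = y^β
Φ^μ_β(z)`. Moving `φ(z)` gives the first sum, by anchor compatibility; moving `c` gives the second.
-/
theorem SmoothBundleMap.IsMorphism.baseDeriv_comp_total [ContMDiffVectorBundle ∞ F' V' I']
    (hΦ : Φ.IsMorphism A A') (hL' : ContMDiff (I'.prod 𝓘(ℝ, F')) 𝓘(ℝ, ℝ) ∞ L')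
    (he : IsLocalFrameOn I F ∞ (fun α x => e α x) u) (huo : IsOpen u')
    (he' : IsLocalFrameOn I' F' ∞ (fun α x => e' α x) u')
    (hθ : ∀ μ, ContMDiff (I'.prod 𝓘(ℝ, F')) 𝓘(ℝ, ℝ) ∞
      (fun v : TotalSpace F' V' => θ μ v.proj v.2))
    (hθu : ∀ μ, ∀ z ∈ u', θ μ z = he'.coeff μ z) {v : TotalSpace F V}
    (hxu : v.proj ∈ u) (hx : Φ.base v.proj ∈ u') (α : ι) :
    A.baseDeriv (L' ∘ Φ.total) he α v
      = ∑ μ, Φ.component θ e μ α v.proj * A'.baseDeriv L' he' μ (Φ.total v)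
        + ∑ μ, (∑ β, he.coeff β v.proj v.2 *
            mvfderiv I (Φ.component θ e μ β) v.proj (A.anchor v.proj (e α v.proj)))
          * fibreDeriv L' (e' μ) (Φ.total v) := by
  obtain ⟨x, w⟩ := v
  change x ∈ u at hxu
  change Φ.base x ∈ u' at hx
  set y : ι → ℝ := fun β => he.coeff β x w with hy
  set c : M → κ → ℝ := fun z μ => ∑ β, y β * Φ.component θ e μ β z with hc
  have hw : ∑ β, y β • e β x = w := he.sum_coeff_smul hxu w
  have hΦw : Φ.fibre x w = ∑ μ, c x μ • e' μ (Φ.base x) := by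
    conv_lhs => rw [← hw]
    exact Φ.fibre_sum_smul he' hθu hx y
  have hcoeff : ∀ μ, he'.coeff μ (Φ.base x) (Φ.fibre x w) = c x μ := fun μ => by
    classical
    rw [hΦw]
    simp [he'.coeff_self hx, -IsLocalFrameOn.coeff_apply_of_mem]
  have hP : ∀ μ β, MDifferentiableAt I 𝓘(ℝ, ℝ) (Φ.component θ e μ β) x := fun μ β =>
    Φ.mdifferentiableAt_component hθ μ β x
  have hcx := hasMFDerivAt_pi_sum_mul hP y
  have hg : MDifferentiableAt (I'.prod 𝓘(ℝ, κ → ℝ)) 𝓘(ℝ, ℝ)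
      (fun q : M' × (κ → ℝ) => L' ⟨q.1, ∑ μ, q.2 μ • e' μ q.1⟩) (Φ.base x, c x) :=
    (hL'.comp (contMDiff_sum_smul_section e')).mdifferentiableAt (by simp)
  have hchain := mvfderiv_comp_prodMk hg (Φ.contMDiff_base.mdifferentiableAt (by simp))
    hcx.mdifferentiableAt (A.anchor x (e α x))
  have hs : (∑ ν, Φ.component θ e ν α x • e' ν : Cₛ^∞⟮I'; F', V'⟯) (Φ.base x)
      = Φ.fibre x (e α x) := by
    rw [ContMDiffSection.sum_smul_apply, Φ.sum_component_smul he' hθu hx]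
  have hf : ContMDiff I' 𝓘(ℝ, ℝ) ∞ (fun z => L' ⟨z, ∑ μ, c x μ • e' μ z⟩) :=
    (hL'.comp (contMDiff_sum_smul_section e')).comp (contMDiff_id.prodMk contMDiff_const)
  have hbase := hΦ.mvfderiv_comp_base hf x (e α) _ hs
  have hB : A.baseDeriv (L' ∘ Φ.total) he α ⟨x, w⟩
      = mvfderiv I (fun z => L' ⟨Φ.base z, ∑ μ, c z μ • e' μ (Φ.base z)⟩) x
        (A.anchor x (e α x)) := by
    have hev : (fun z => (L' ∘ Φ.total) ⟨z, ∑ β, y β • e β z⟩) =ᶠ[nhds x]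
        fun z => L' ⟨Φ.base z, ∑ μ, c z μ • e' μ (Φ.base z)⟩ := by
      filter_upwards [(huo.preimage Φ.contMDiff_base.continuous).mem_nhds hx] with z hz
      simp only [Function.comp_apply, SmoothBundleMap.total, hc,
        Φ.fibre_sum_smul he' hθu hz y]
    change mvfderiv I (fun z => (L' ∘ Φ.total) ⟨z, ∑ β, y β • e β z⟩) x _ = _
    exact congrArg (fun l : TangentSpace I x →L[ℝ] ℝ => l (A.anchor x (e α x)))
      (hev.mfderiv_eq (I := I) (I' := 𝓘(ℝ, ℝ)))
  have hv : mvfderiv I c x (A.anchor x (e α x))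
      = fun μ => ∑ β, y β * mvfderiv I (Φ.component θ e μ β) x (A.anchor x (e α x)) := by
    have h1 : mvfderiv I c x = ContinuousLinearMap.pi
        fun μ => ∑ β, y β • mvfderiv I (Φ.component θ e μ β) x := hcx.mfderiv
    rw [h1]
    funext μ
    simp
  have htot : Φ.total ⟨x, w⟩ = ⟨Φ.base x, ∑ μ, c x μ • e' μ (Φ.base x)⟩ := by
    rw [← hΦw]; rfl
  have hB' : ∀ μ, A'.baseDeriv L' he' μ (Φ.total ⟨x, w⟩)
      = mvfderiv I' (fun z => L' ⟨z, ∑ μ, c x μ • e' μ z⟩) (Φ.base x)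
        (A'.anchor (Φ.base x) (e' μ (Φ.base x))) := fun μ => by
    change mvfderiv I' (fun z => L' ⟨z, ∑ ν, he'.coeff ν (Φ.base x) (Φ.fibre x w) • e' ν z⟩)
      (Φ.base x) (A'.anchor (Φ.base x) (e' μ (Φ.base x))) = _
    simp only [hcoeff]
  rw [hB]
  refine hchain.trans ?_
  rw [hbase, fderiv_eq_sum_fibreDeriv hL', hv, ← htot]
  congr 1
  rw [ContMDiffSection.sum_smul_apply]
  simp only [hB', map_sum, map_smul, smul_eq_mul]

end

/-! ### Lagrange's equations along the path -/

theorem mainTheorem3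
    {EM : Type*} [NormedAddCommGroup EM] [NormedSpace ℝ EM] [FiniteDimensional ℝ EM]
    {M : Type*} [TopologicalSpace M] [T2Space M] [ChartedSpace EM M] [IsManifold 𝓘(ℝ, EM) ∞ M]
    {F : Type*} [NormedAddCommGroup F] [NormedSpace ℝ F] [FiniteDimensional ℝ F]
    {V : M → Type*} [TopologicalSpace (TotalSpace F V)]
    [∀ x, AddCommGroup (V x)] [∀ x, Module ℝ (V x)] [∀ x, TopologicalSpace (V x)]
    [FiberBundle F V] [VectorBundle ℝ F V] [ContMDiffVectorBundle ∞ F V 𝓘(ℝ, EM)]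
    {EM' : Type*} [NormedAddCommGroup EM'] [NormedSpace ℝ EM'] [FiniteDimensional ℝ EM']
    {M' : Type*} [TopologicalSpace M'] [T2Space M'] [ChartedSpace EM' M']
    [IsManifold 𝓘(ℝ, EM') ∞ M']
    {F' : Type*} [NormedAddCommGroup F'] [NormedSpace ℝ F'] [FiniteDimensional ℝ F']
    {V' : M' → Type*} [TopologicalSpace (TotalSpace F' V')]
    [∀ x, AddCommGroup (V' x)] [∀ x, Module ℝ (V' x)] [∀ x, TopologicalSpace (V' x)]
    [FiberBundle F' V'] [VectorBundle ℝ F' V'] [ContMDiffVectorBundle ∞ F' V' 𝓘(ℝ, EM')]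
    (A : LieAlgebroid 𝓘(ℝ, EM) F V) (A' : LieAlgebroid 𝓘(ℝ, EM') F' V')
    (Φ : SmoothBundleMap 𝓘(ℝ, EM) F V 𝓘(ℝ, EM') F' V') (hΦ : Φ.IsMorphism A A')
    (L : TotalSpace F V → ℝ) (hL : ContMDiff (𝓘(ℝ, EM).prod 𝓘(ℝ, F)) 𝓘(ℝ, ℝ) ∞ L)
    (L' : TotalSpace F' V' → ℝ) (hL' : ContMDiff (𝓘(ℝ, EM').prod 𝓘(ℝ, F')) 𝓘(ℝ, ℝ) ∞ L')
    (hLL' : L = L' ∘ Φ.total)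
    (t₀ t₁ : ℝ) (ht : t₀ < t₁) (a : ℝ → TotalSpace F V) (ha : A.IsPath t₀ t₁ a)
    (ha' : A'.SolvesLagrange L' t₀ t₁ (Φ.total ∘ a)) :
    A.SolvesLagrange L t₀ t₁ a := by
  subst hLL'
  refine ⟨ha, fun u huo e he t htI htu α => ?_⟩
  obtain ⟨u', e', he', θ, huo', hxu', hθ, hθu⟩ :=
    exists_global_frame (I := 𝓘(ℝ, EM')) (F := F') (V := V') (Φ.base (a t).proj)
  choose p' hp' heq' using fun μ => ha'.lagrange u' huo' e' he' t htI hxu' μ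
  have hγ := ha.admissible t htI
  -- The velocity `ρ(a) = y^l ρ(e_l)` turns the time derivative of `Φ^μ_β` into `y^l ρ(e_l)Φ^μ_β`.
  have hP : ∀ μ β, HasDerivWithinAt (fun s => Φ.component θ e μ β (a s).proj)
      (∑ l, he.coeff l (a t).proj (a t).2 * mvfderiv 𝓘(ℝ, EM) (Φ.component θ e μ β) (a t).proj
        (A.anchor (a t).proj (e l (a t).proj))) (Icc t₀ t₁) t := fun μ β => by
    have h := hasDerivWithinAt_comp_mvfderiv
      (Φ.mdifferentiableAt_component (e := e) hθ μ β (a t).proj) hγ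
    rw [← he.sum_coeff_smul htu (a t).2] at h
    simpa only [map_sum, map_smul, smul_eq_mul] using h
  have hev : (fun s => fibreDeriv (L' ∘ Φ.total) (e α) (a s)) =ᶠ[nhdsWithin t (Icc t₀ t₁)]
      fun s => ∑ μ, Φ.component θ e μ α (a s).proj * fibreDeriv L' (e' μ) (Φ.total (a s)) := by
    have hO := (huo'.preimage Φ.contMDiff_base.continuous).mem_nhds hxu'
    filter_upwards [hγ.continuousWithinAt.eventually hO] with s hs
    exact fibreDeriv_comp_total hL' he' hθu α hs
  -- The Leibniz rule, applied to `Φ^μ_α ∂L'/∂y'^μ`, supplies the witness for the time derivative of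
  -- `∂L/∂y^α`.
  refine ⟨_, (HasDerivWithinAt.fun_sum fun μ _ => (hP μ α).mul (hp' μ)).congr_of_eventuallyEq hev
    (hev.eq_of_nhdsWithin htI), ?_⟩
  simp only [fibreDeriv_comp_total hL' he' hθu _ hxu']
  refine lagrange_change_of_frame α (fun μ β => Φ.component θ e μ β (a t).proj)
    (fun β μ γ => mvfderiv 𝓘(ℝ, EM) (Φ.component θ e μ γ) (a t).proj
        (A.anchor (a t).proj (e β (a t).proj)))
    (fun β γ => A.structureFun he α β γ (a t).proj)
    (fun ν l μ => A'.structureFun he' ν l μ (Φ.base (a t).proj))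
    (fun μ => fibreDeriv L' (e' μ) (Φ.total (a t))) p'
    (fun μ => A'.baseDeriv L' he' μ (Φ.total (a t)))
    (fun μ => he'.coeff μ (Φ.base (a t).proj) (Φ.fibre (a t).proj (a t).2))
    (fun β => he.coeff β (a t).proj (a t).2) _ heq'
    (fun μ β => hΦ.structure_equation he huo' he' hθ hθu htu hxu' α β μ) (fun μ => ?_)
    (hΦ.baseDeriv_comp_total hL' he huo' he' hθ hθu htu hxu' α)
  -- What remains is `y'^μ = y^β Φ^μ_β` at `a t`.
  rw [← hθu _ _ hxu']
  conv_lhs => rw [← he.sum_coeff_smul htu (a t).2]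
  simp only [map_sum, map_smul, smul_eq_mul, SmoothBundleMap.component]

end
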